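/- Let $d\ge 0$ and $m\ge 1$ be integers, and let $f\in\mathcal D(\mathbb R^d)'$ be a complex valued Schwartz distribution. For a linear map $c:\mathbb R^d\to\mathbb R^d$ let $f(x+cy)\in\mathcal D(\mathbb R^d\times\mathbb R^d)'$ be the distribution $\Phi\mapsto f\{z\mapsto\int_{\mathbb R^d}\Phi(z-cy,y)\,dy\}$, and let $f(x)\cdot 1(y)\in\mathcal D(\mathbb R^d\times\mathbb R^d)'$ be the distribution $\Phi\mapsto f\{x\mapsto\int_{\mathbb R^d}\Phi(x,y)\,dy\}$. Let $\varepsilon=1$ or $\varepsilon=(-1)^m$, and assume that $$\varepsilon\, f(x)\cdot 1(y)+\sum_{i=1}^m\binom{m}{i}(-1)^{m-i}f(x+iy)=0\quad\text{in }\mathcal D(\mathbb R^d\times\mathbb R^d)'.$$ Then $f$ is equal almost everywhere to a continuous polynomial function on $\mathbb R^d$ of total degree $\le m-1$; that is, there is a polynomial $P$ in $d$ variables with complex coefficients and total degree at most $m-1$ such that $f\{\varphi\}=\int_{\mathbb R^d}\varphi(x)P(x)\,dx$ for every test function $\varphi\in\mathcal D(\mathbb R^d)$. -/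

import Mathlib

open MeasureTheory TopologicalSpace Set
open scoped Distributions ContDiff

namespace FrechetDistribution

set_option linter.unusedSectionVars false

noncomputable section

section ParametricIntegral

variable {E : Type} [NormedAddCommGroup E] [NormedSpace ℝ E]
  [MeasurableSpace E] [BorelSpace E] {μ : Measure E} [IsFiniteMeasureOnCompacts μ]
  {G : Type} [NormedAddCommGroup G] [NormedSpace ℝ G]

theorem integrable_slice {Ψ : E × E → G} (hc : Continuous Ψ) (hs : HasCompactSupport Ψ) (z : E) :
    Integrable (fun y ↦ Ψ (z, y)) μ := by
  refine Continuous.integrable_of_hasCompactSupport (by fun_prop) ?_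
  refine HasCompactSupport.intro (hs.isCompact.image continuous_snd) fun y hy ↦ ?_
  exact image_eq_zero_of_notMem_tsupport fun h ↦ hy ⟨_, h, rfl⟩

/-- Differentiation under the integral sign for a compactly supported integrand. -/
theorem hasFDerivAt_fiberIntegral {Ψ : E × E → G} (hΨ : ContDiff ℝ ∞ Ψ)
    (hs : HasCompactSupport Ψ) (z : E) :
    HasFDerivAt (fun x ↦ ∫ y, Ψ (x, y) ∂μ)
      (∫ y, (fderiv ℝ Ψ (z, y)).comp (ContinuousLinearMap.inl ℝ E E) ∂μ) z := by
  have hd : Differentiable ℝ Ψ := hΨ.differentiable (by simp)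
  have hc' : Continuous (fderiv ℝ Ψ) := hΨ.continuous_fderiv (by simp)
  have hs' : HasCompactSupport (fderiv ℝ Ψ) := hs.fderiv ℝ
  obtain ⟨C, hC⟩ := hc'.bounded_above_of_compact_support hs'
  have hC0 : 0 ≤ C := (norm_nonneg _).trans (hC 0)
  let k : Set E := Prod.snd '' tsupport Ψ
  have hk : IsCompact k := hs.isCompact.image continuous_snd
  refine hasFDerivAt_integral_of_dominated_of_fderiv_le (s := univ)
    (F := fun x y ↦ Ψ (x, y))
    (F' := fun x y ↦ (fderiv ℝ Ψ (x, y)).comp (ContinuousLinearMap.inl ℝ E E))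
    (bound := k.indicator fun _ ↦ C * ‖ContinuousLinearMap.inl ℝ E E‖)
    Filter.univ_mem ?_ ?_ ?_ ?_ ?_ ?_
  · exact Filter.Eventually.of_forall fun x ↦
      (integrable_slice hΨ.continuous hs x).aestronglyMeasurable
  · exact integrable_slice hΨ.continuous hs z
  · refine (integrable_slice (μ := μ)
      (Ψ := fun w ↦ (fderiv ℝ Ψ w).comp (ContinuousLinearMap.inl ℝ E E))
      (by fun_prop) ?_ z).aestronglyMeasurable
    exact hs'.comp_left (g := fun A : E × E →L[ℝ] G ↦
      A.comp (ContinuousLinearMap.inl ℝ E E)) (by simp)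
  · refine Filter.Eventually.of_forall fun y x _ ↦ ?_
    by_cases hy : y ∈ k
    · rw [indicator_of_mem hy]
      exact (ContinuousLinearMap.opNorm_comp_le _ _).trans
        (mul_le_mul_of_nonneg_right (hC _) (norm_nonneg _))
    · have h0 : fderiv ℝ Ψ (x, y) = 0 := by
        by_contra h
        exact hy ⟨_, support_fderiv_subset ℝ h, rfl⟩
      simp [h0, indicator_of_notMem hy]
  · rw [integrable_indicator_iff hk.measurableSet]
    exact integrableOn_const hk.measure_lt_top.ne
  · refine Filter.Eventually.of_forall fun y x _ ↦ ?_
    have h1 : HasFDerivAt (fun x : E ↦ (x, y)) (ContinuousLinearMap.inl ℝ E E) x :=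
      hasFDerivAt_prodMk_left x y
    exact (hd (x, y)).hasFDerivAt.comp x h1

end ParametricIntegral

theorem contDiff_fiberIntegral_nat {E : Type} [NormedAddCommGroup E] [NormedSpace ℝ E]
    [MeasurableSpace E] [BorelSpace E] {μ : Measure E} [IsFiniteMeasureOnCompacts μ] (n : ℕ) :
    ∀ (G : Type) [NormedAddCommGroup G] [NormedSpace ℝ G] (Ψ : E × E → G),
      ContDiff ℝ ∞ Ψ → HasCompactSupport Ψ → ContDiff ℝ n (fun x ↦ ∫ y, Ψ (x, y) ∂μ) := by
  induction n with
  | zero =>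
    intro G _ _ Ψ hΨ hs
    exact contDiff_zero.2 (continuous_iff_continuousAt.2 fun z ↦
      (hasFDerivAt_fiberIntegral hΨ hs z).continuousAt)
  | succ n ih =>
    intro G _ _ Ψ hΨ hs
    push_cast
    rw [contDiff_succ_iff_fderiv]
    refine ⟨fun z ↦ (hasFDerivAt_fiberIntegral hΨ hs z).differentiableAt, by simp, ?_⟩
    rw [show fderiv ℝ (fun x ↦ ∫ y, Ψ (x, y) ∂μ) = _ from
      funext fun z ↦ (hasFDerivAt_fiberIntegral hΨ hs z).fderiv]
    refine ih _ (fun w ↦ (fderiv ℝ Ψ w).comp (ContinuousLinearMap.inl ℝ E E)) ?_ ?_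
    · exact (hΨ.fderiv_right (m := ∞) (by simp)).clm_comp contDiff_const
    · exact (hs.fderiv ℝ).comp_left (g := fun A : E × E →L[ℝ] G ↦
        A.comp (ContinuousLinearMap.inl ℝ E E)) (by simp)

theorem norm_iteratedFDeriv_fiberIntegral_le {E : Type} [NormedAddCommGroup E] [NormedSpace ℝ E]
    [MeasurableSpace E] [BorelSpace E] {μ : Measure E} [IsFiniteMeasureOnCompacts μ]
    {k : Set E} (hk : IsCompact k) {C : ℝ} (n : ℕ) :
    ∀ (G : Type) [NormedAddCommGroup G] [NormedSpace ℝ G] (Ψ : E × E → G),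
      ContDiff ℝ ∞ Ψ → HasCompactSupport Ψ → (∀ x y, y ∉ k → Ψ (x, y) = 0) →
      (∀ w, ‖iteratedFDeriv ℝ n Ψ w‖ ≤ C) →
      ∀ z, ‖iteratedFDeriv ℝ n (fun x ↦ ∫ y, Ψ (x, y) ∂μ) z‖ ≤ C * μ.real k := by
  induction n with
  | zero =>
    intro G _ _ Ψ hΨ hs h0 hC z
    simp only [norm_iteratedFDeriv_zero] at hC ⊢
    rw [← setIntegral_eq_integral_of_forall_compl_eq_zero (s := k) fun y hy ↦ h0 z y hy]
    exact norm_setIntegral_le_of_norm_le_const hk.measure_lt_top fun y _ ↦ hC _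
  | succ n ih =>
    intro G _ _ Ψ hΨ hs h0 hC z
    rw [← norm_iteratedFDeriv_fderiv]
    rw [show fderiv ℝ (fun x ↦ ∫ y, Ψ (x, y) ∂μ) = _ from
      funext fun z ↦ (hasFDerivAt_fiberIntegral hΨ hs z).fderiv]
    have hd : ContDiff ℝ ∞ (fderiv ℝ Ψ) := hΨ.fderiv_right (m := ∞) (by simp)
    refine ih _ (fun w ↦ (fderiv ℝ Ψ w).comp (ContinuousLinearMap.inl ℝ E E)) ?_ ?_ ?_ ?_ z
    · exact hd.clm_comp contDiff_const
    · exact (hs.fderiv ℝ).comp_left (g := fun A : E × E →L[ℝ] G ↦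
        A.comp (ContinuousLinearMap.inl ℝ E E)) (by simp)
    · intro x y hy
      have h : fderiv ℝ Ψ (x, y) = 0 := by
        have he : Ψ =ᶠ[nhds (x, y)] fun _ ↦ (0 : G) := by
          have ho : IsOpen (Prod.snd ⁻¹' kᶜ : Set (E × E)) :=
            hk.isClosed.isOpen_compl.preimage continuous_snd
          filter_upwards [ho.mem_nhds (show (x, y) ∈ Prod.snd ⁻¹' kᶜ from hy)] with w hw
          exact h0 w.1 w.2 hw
        rw [he.fderiv_eq]
        simp
      simp [h]
    · intro w
      let R : (E × E →L[ℝ] G) →L[ℝ] (E →L[ℝ] G) :=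
        (ContinuousLinearMap.compL ℝ E (E × E) G).flip (ContinuousLinearMap.inl ℝ E E)
      have hR : ‖R‖ ≤ 1 := by
        refine ContinuousLinearMap.opNorm_le_bound _ zero_le_one fun A ↦ ?_
        refine (ContinuousLinearMap.opNorm_comp_le A _).trans ?_
        rw [mul_comm]
        exact mul_le_mul_of_nonneg_right (ContinuousLinearMap.norm_inl_le_one ℝ E E)
          (norm_nonneg _)
      have h := R.norm_iteratedFDeriv_comp_left (x := w) (N := ∞) (n := n) hd.contDiffAt
        (by exact_mod_cast le_top)
      refine h.trans ?_
      rw [norm_iteratedFDeriv_fderiv]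
      calc ‖R‖ * ‖iteratedFDeriv ℝ (n + 1) Ψ w‖ ≤ 1 * C := by
            gcongr
            exact hC w
        _ = C := one_mul C

section Pushforward

variable {E : Type} [NormedAddCommGroup E] [NormedSpace ℝ E]

/-- The linear automorphism `(z, y) ↦ (z - c y, y)` of `E × E`, inverse to
`(x, y) ↦ (x + c y, y)`. -/
def shear (c : E →L[ℝ] E) : (E × E) ≃L[ℝ] (E × E) :=
  ContinuousLinearEquiv.equivOfInverse
    ((ContinuousLinearMap.fst ℝ E E - c.comp (ContinuousLinearMap.snd ℝ E E)).prod
      (ContinuousLinearMap.snd ℝ E E))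
    ((ContinuousLinearMap.fst ℝ E E + c.comp (ContinuousLinearMap.snd ℝ E E)).prod
      (ContinuousLinearMap.snd ℝ E E))
    (fun w ↦ by simp) (fun w ↦ by simp)

theorem shear_apply (c : E →L[ℝ] E) (z y : E) : shear c (z, y) = (z - c y, y) := rfl

theorem contDiff_comp_shear (c : E →L[ℝ] E) {Φ : E × E → ℝ} (h : ContDiff ℝ ∞ Φ) :
    ContDiff ℝ ∞ (Φ ∘ shear c) :=
  h.comp (shear c).contDiff

theorem hasCompactSupport_comp_shear (c : E →L[ℝ] E) {Φ : E × E → ℝ}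
    (h : HasCompactSupport Φ) : HasCompactSupport (Φ ∘ shear c) :=
  h.comp_homeomorph (shear c).toHomeomorph

variable [MeasurableSpace E] [BorelSpace E] (μ : Measure E) [IsFiniteMeasureOnCompacts μ]

/-- The function `z ↦ ∫ Φ(z - c y, y) dy`. -/
def fiberFun (c : E →L[ℝ] E) (Φ : E × E → ℝ) (z : E) : ℝ := ∫ y, Φ (z - c y, y) ∂μ

theorem contDiff_fiberFun (c : E →L[ℝ] E) {Φ : E × E → ℝ} (h : ContDiff ℝ ∞ Φ)
    (hs : HasCompactSupport Φ) : ContDiff ℝ ∞ (fiberFun μ c Φ) :=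
  contDiff_infty.2 fun n ↦ contDiff_fiberIntegral_nat n ℝ _
    (contDiff_comp_shear c h) (hasCompactSupport_comp_shear c hs)

theorem fiberFun_eq_zero (c : E →L[ℝ] E) {Φ : E × E → ℝ} {K : Set (E × E)}
    (h : ∀ w ∉ K, Φ w = 0) {z : E} (hz : z ∉ (fun w : E × E ↦ w.1 + c w.2) '' K) :
    fiberFun μ c Φ z = 0 := by
  have h0 : ∀ y, Φ (z - c y, y) = 0 := fun y ↦ h _ fun hw ↦ hz ⟨_, hw, by simp⟩
  simp [fiberFun, h0]

theorem isCompact_image_add (c : E →L[ℝ] E) {K : Set (E × E)} (hK : IsCompact K) :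
    IsCompact ((fun w : E × E ↦ w.1 + c w.2) '' K) :=
  hK.image (by fun_prop)

theorem fiberFun_add (c : E →L[ℝ] E) {Φ Ψ : E × E → ℝ} (hΦ : ContDiff ℝ ∞ Φ)
    (hsΦ : HasCompactSupport Φ) (hΨ : ContDiff ℝ ∞ Ψ) (hsΨ : HasCompactSupport Ψ) (z : E) :
    fiberFun μ c (Φ + Ψ) z = fiberFun μ c Φ z + fiberFun μ c Ψ z :=
  integral_add
    (integrable_slice (contDiff_comp_shear c hΦ).continuous
      (hasCompactSupport_comp_shear c hsΦ) z)
    (integrable_slice (contDiff_comp_shear c hΨ).continuous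
      (hasCompactSupport_comp_shear c hsΨ) z)

theorem fiberFun_smul (c : E →L[ℝ] E) (r : ℝ) (Φ : E × E → ℝ) (z : E) :
    fiberFun μ c (r • Φ) z = r • fiberFun μ c Φ z :=
  integral_smul r _

/-- `fiberFun` on test functions supported in a fixed compact set, as a linear map. -/
def fiberSupportedLM (c : E →L[ℝ] E) (K : Compacts (E × E)) (K' : Compacts E)
    (hK' : (fun w : E × E ↦ w.1 + c w.2) '' K ⊆ K') : 𝓓_{K}(E × E, ℝ) →ₗ[ℝ] 𝓓_{K'}(E, ℝ) where
  toFun Φ := ⟨fiberFun μ c Φ, contDiff_fiberFun μ c Φ.contDiff Φ.hasCompactSupport,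
    fun _ hz ↦ fiberFun_eq_zero μ c (fun _ hw ↦ Φ.zero_on_compl hw) fun h ↦ hz (hK' h)⟩
  map_add' Φ Ψ := ContDiffMapSupportedIn.ext fun z ↦ fiberFun_add μ c Φ.contDiff
    Φ.hasCompactSupport Ψ.contDiff Ψ.hasCompactSupport z
  map_smul' r Φ := ContDiffMapSupportedIn.ext fun z ↦ fiberFun_smul μ c r Φ z

theorem continuous_fiberSupportedLM (c : E →L[ℝ] E) (K : Compacts (E × E)) (K' : Compacts E)
    (hK' : (fun w : E × E ↦ w.1 + c w.2) '' K ⊆ K') :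
    Continuous (fiberSupportedLM μ c K K' hK') := by
  refine WithSeminorms.continuous_of_isBounded
    (ContDiffMapSupportedIn.withSeminorms ℝ (E × E) ℝ ⊤ K)
    (ContDiffMapSupportedIn.withSeminorms ℝ E ℝ ⊤ K') _ (.of_real fun i ↦ ?_)
  let k : Set E := Prod.snd '' (K : Set (E × E))
  have hk : IsCompact k := K.isCompact.image continuous_snd
  let L : E × E →L[ℝ] E × E := shear c
  refine ⟨{i}, ‖L‖ ^ i * μ.real k, fun Φ ↦ ?_⟩
  set N := ContDiffMapSupportedIn.seminorm ℝ (E × E) ℝ ⊤ K i Φ with hN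
  have hN0 : 0 ≤ N := apply_nonneg _ _
  have hgoal : ContDiffMapSupportedIn.seminorm ℝ E ℝ ⊤ K' i (fiberSupportedLM μ c K K' hK' Φ)
      ≤ (N * ‖L‖ ^ i) * μ.real k := by
    refine (ContDiffMapSupportedIn.seminorm_top_le_iff ℝ (by positivity) i _).2 fun z _ ↦ ?_
    refine norm_iteratedFDeriv_fiberIntegral_le (μ := μ) hk i ℝ (Φ ∘ shear c)
      (contDiff_comp_shear c Φ.contDiff) (hasCompactSupport_comp_shear c Φ.hasCompactSupport)
      ?_ ?_ z
    · intro x y hy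
      exact Φ.zero_on_compl fun hw ↦ hy ⟨_, hw, rfl⟩
    · intro w
      have h1 := L.iteratedFDeriv_comp_right (f := Φ) (n := ∞) Φ.contDiff w (i := i)
        (by exact_mod_cast le_top)
      change ‖iteratedFDeriv ℝ i (Φ ∘ L) w‖ ≤ _
      rw [h1]
      refine (ContinuousMultilinearMap.norm_compContinuousLinearMap_le _ _).trans ?_
      rw [Finset.prod_const, Finset.card_univ, Fintype.card_fin]
      gcongr
      exact ContDiffMapSupportedIn.norm_iteratedFDeriv_apply_le_seminorm_top ℝ
  refine hgoal.trans (le_of_eq ?_)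
  simp only [Finset.sup_singleton]
  rw [← hN]
  ring

/-- The continuous linear map `𝓓(E × E) → 𝓓(E)`, `Φ ↦ (z ↦ ∫ Φ(z - c y, y) dy)`. It is the
transpose of the operation taking a function `f` on `E` to the function
`(x, y) ↦ f (x + c y)` on `E × E`. -/
def fiberCLM (c : E →L[ℝ] E) :
    𝓓((⊤ : Opens (E × E)), ℝ) →L[ℝ] 𝓓((⊤ : Opens E), ℝ) :=
  TestFunction.limitCLM ℝ
    (fun Φ ↦ ⟨fiberFun μ c Φ, contDiff_fiberFun μ c Φ.contDiff Φ.hasCompactSupport,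
      HasCompactSupport.intro (isCompact_image_add c Φ.hasCompactSupport.isCompact)
        fun _ hz ↦ fiberFun_eq_zero μ c
          (fun _ hw ↦ image_eq_zero_of_notMem_tsupport hw) hz,
      fun _ _ ↦ mem_univ _⟩)
    (fun K _ ↦
      (TestFunction.ofSupportedInCLM ℝ
        (K := ⟨_, isCompact_image_add c K.isCompact⟩) (subset_univ _)).comp
      ⟨fiberSupportedLM μ c K ⟨_, isCompact_image_add c K.isCompact⟩ subset_rfl,
        continuous_fiberSupportedLM μ c K _ subset_rfl⟩)
    (fun _ _ _ ↦ rfl)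

theorem fiberCLM_apply (c : E →L[ℝ] E) (Φ : 𝓓((⊤ : Opens (E × E)), ℝ)) (z : E) :
    fiberCLM μ c Φ z = ∫ y, Φ (z - c y, y) ∂μ := rfl

end Pushforward

/-- `ℝ^d` with its Euclidean norm and Lebesgue measure `volume`. -/
abbrev Space (d : ℕ) : Type := EuclideanSpace ℝ (Fin d)

/-- Complex valued Schwartz distributions on `ℝ^d`. -/
abbrev Dist (d : ℕ) : Type := 𝓓'((⊤ : Opens (Space d)), ℂ)

/-- Complex valued Schwartz distributions on `ℝ^d × ℝ^d`. -/
abbrev DistProd (d : ℕ) : Type := 𝓓'((⊤ : Opens (Space d × Space d)), ℂ)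

variable {d : ℕ}

/-- The distribution `f(x + c y)` on `ℝ^d × ℝ^d`, given by `Φ ↦ f {z ↦ ∫ Φ(z - c y, y) dy}`. -/
def compAdd (f : Dist d) (c : Space d →L[ℝ] Space d) : DistProd d :=
  (fiberCLM volume c).precompCompactConvergenceCLM ℂ f

/-- The distribution `f(x)·1(y)` on `ℝ^d × ℝ^d`, given by `Φ ↦ f {x ↦ ∫ Φ(x, y) dy}`. -/
def tensorOne (f : Dist d) : DistProd d :=
  (fiberCLM volume 0).precompCompactConvergenceCLM ℂ f

/-- On a product `φ₁(x) φ₂(y)`, the value of `f(x + c y)` is `f` applied to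
`z ↦ ∫ φ₁(z - c y) φ₂(y) dy`. For invertible `c` this function is
`|det c|⁻¹ φ₁ ∗ (φ₂ ∘ c⁻¹)`. -/
theorem compAdd_apply_prod (f : Dist d) (c : Space d →L[ℝ] Space d)
    (Φ : 𝓓((⊤ : Opens (Space d × Space d)), ℝ)) (φ₁ φ₂ ψ : 𝓓((⊤ : Opens (Space d)), ℝ))
    (hΦ : ∀ x y, Φ (x, y) = φ₁ x * φ₂ y) (hψ : ∀ z, ψ z = ∫ y, φ₁ (z - c y) * φ₂ y) :
    compAdd f c Φ = f ψ := by
  change f (fiberCLM volume c Φ) = f ψ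
  congr 1
  ext z
  rw [fiberCLM_apply, hψ]
  simp only [hΦ]

/-- On a product `φ₁(x) φ₂(y)`, the value of `f(x)·1(y)` is `f{φ₁} ∫ φ₂`. -/
theorem tensorOne_apply_prod (f : Dist d)
    (Φ : 𝓓((⊤ : Opens (Space d × Space d)), ℝ)) (φ₁ φ₂ : 𝓓((⊤ : Opens (Space d)), ℝ))
    (hΦ : ∀ x y, Φ (x, y) = φ₁ x * φ₂ y) :
    tensorOne f Φ = f φ₁ * ((∫ y, φ₂ y : ℝ) : ℂ) := by
  change f (fiberCLM volume 0 Φ) = _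
  have h : fiberCLM volume 0 Φ = (∫ y, φ₂ y) • φ₁ := by
    ext z
    rw [fiberCLM_apply]
    simp only [hΦ, zero_apply, sub_zero]
    rw [integral_const_mul, mul_comm]
    rfl
  rw [h, map_smul, Complex.real_smul, mul_comm]

/-- The distribution `f` is (almost everywhere equal to) the locally integrable function `g`. -/
def EqFunction (f : Dist d) (g : Space d → ℂ) : Prop :=
  LocallyIntegrable g volume ∧
    ∀ φ : 𝓓((⊤ : Opens (Space d)), ℝ), f φ = ∫ x, (φ x : ℂ) * g x

/-- The polynomial function on `ℝ^d` with complex coefficients given by `P`. -/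
def polyFun (P : MvPolynomial (Fin d) ℂ) (x : Space d) : ℂ :=
  MvPolynomial.eval (fun j ↦ (x j : ℂ)) P

end

end FrechetDistribution

namespace FrechetDistribution

/-! ### Smooth solutions are polynomials: differences and Taylor's formula. -/

section Polynomial

/-! The equation regularizes `f`. Tested against `φ(x) ψ(y)` with `∫ ψ = 1`, its first term gives `ε
f(φ)`, and each other term gives `f` at the convolution of `φ` with a normalized dilate of `ψ`. As
`ε ≠ 0`, there is one test function `θ` with `f(φ) = f(φ ∗ θ)` for all `φ`
(`exists_eq_fiberCLM_convKernel`).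

Moving `f` inside the convolution integral (`continuous_slice_and_fiberCLM_eq_integral`) shows that
`f` is the function `g(u) = f(θ(· - u))`, and `g` is smooth because it is itself a convolution with
a test function (`exists_contDiff_eq_integral`).

Being continuous, `g` solves the equation pointwise (`pointwise_eq_zero`). With `s • y` in place of
`y`, `m` derivatives in `s` at `0` kill the term `ε g(x)` and leave `m!` times the `m`-th derivative
of `g` at `x` along `y`. So this derivative vanishes, and Taylor's formula makes `g` a polynomial of
degree at most `m - 1` (`exists_polyFun_eq`). -/

theorem iteratedDeriv_comp_add_smul {E F : Type*} [NormedAddCommGroup E] [NormedSpace ℝ E]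
    [NormedAddCommGroup F] [NormedSpace ℝ F] {g : E → F} (hg : ContDiff ℝ ∞ g) (x y : E) (n : ℕ) :
    iteratedDeriv n (fun s : ℝ ↦ g (x + s • y)) =
      fun s ↦ iteratedFDeriv ℝ n g (x + s • y) fun _ ↦ y := by
  induction n with
  | zero => ext s; simp
  | succ n ih =>
    rw [iteratedDeriv_succ, ih]
    ext s
    exact ContDiffAt.deriv_fderiv_add_smul (hg.contDiffAt.of_le (by exact_mod_cast le_top))

/-- The sum is the `m`-th forward difference of `t ↦ t ^ m` at `0`; its term `i = 0` vanishes
because `m ≥ 1`. -/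
theorem sum_choose_mul_pow_eq_factorial {m : ℕ} (hm : 1 ≤ m) :
    ∑ i ∈ Finset.Icc 1 m, ((m.choose i : ℝ) * (-1) ^ (m - i)) * (i : ℝ) ^ m = m.factorial := by
  have h := congrFun (fwdDiff_iter_eq_factorial (R := ℝ) (n := m)) 0
  rw [fwdDiff_iter_eq_sum_shift, Finset.range_eq_Ico, Finset.sum_eq_sum_Ico_succ_bot (by omega)] at h
  simp only [zsmul_eq_mul, zero_add, nsmul_eq_mul, mul_one, Nat.cast_zero,
    zero_pow (show m ≠ 0 by omega), mul_zero, Pi.natCast_apply] at h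
  rw [← h, ← Finset.Ico_succ_right_eq_Icc]
  refine Finset.sum_congr rfl fun i _ ↦ ?_
  push_cast
  ring

/-- A smooth solution of the Fréchet equation has vanishing `m`-th directional derivatives. -/
theorem iteratedFDeriv_apply_const_eq_zero {E : Type*} [NormedAddCommGroup E] [NormedSpace ℝ E]
    {m : ℕ} (hm : 1 ≤ m) {ε : ℝ} {g : E → ℂ} (hg : ContDiff ℝ ∞ g)
    (h : ∀ x y, ε • g x + ∑ i ∈ Finset.Icc 1 m,
      ((m.choose i : ℝ) * (-1) ^ (m - i)) • g (x + (i : ℝ) • y) = 0) (x y : E) :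
    iteratedFDeriv ℝ m g x (fun _ ↦ y) = 0 := by
  let F : ℕ → ℝ → ℂ := fun i s ↦ ((m.choose i : ℝ) * (-1) ^ (m - i)) • g (x + s • (i : ℝ) • y)
  -- With `s • y` for `y`, the equation says that this sum does not depend on `s`.
  have hsum : (fun s : ℝ ↦ ∑ i ∈ Finset.Icc 1 m, F i s) = fun _ ↦ -(ε • g x) := by
    ext1 s
    have := h x (s • y)
    simp only [smul_comm _ s y] at this
    exact (neg_eq_of_add_eq_zero_right this).symm
  have hG : ∀ i : ℕ, ContDiff ℝ ∞ fun s : ℝ ↦ g (x + s • (i : ℝ) • y) := fun i ↦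
    hg.comp (by fun_prop)
  have hle : ((m : ℕ∞) : WithTop ℕ∞) ≤ ∞ := by exact_mod_cast le_top
  have h1 : iteratedDeriv m (fun s : ℝ ↦ ∑ i ∈ Finset.Icc 1 m, F i s) 0 = 0 := by
    rw [hsum, iteratedDeriv_const, if_neg (by omega)]
  rw [iteratedDeriv_fun_sum fun i _ ↦ (((hG i).const_smul _).of_le hle).contDiffAt] at h1
  have h2 : ∀ i : ℕ, iteratedDeriv m (F i) 0 = (((m.choose i : ℝ) * (-1) ^ (m - i)) * (i : ℝ) ^ m) •
      iteratedFDeriv ℝ m g x (fun _ ↦ y) := by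
    intro i
    rw [show F i = fun s : ℝ ↦ ((m.choose i : ℝ) * (-1) ^ (m - i)) • g (x + s • (i : ℝ) • y) from rfl,
      iteratedDeriv_fun_const_smul ((hG i).of_le hle).contDiffAt, iteratedDeriv_comp_add_smul hg]
    simp only [zero_smul, add_zero]
    rw [ContinuousMultilinearMap.map_smul_univ (iteratedFDeriv ℝ m g x) (fun _ ↦ (i : ℝ))
      (fun _ ↦ y), smul_smul]
    simp
  rw [Finset.sum_congr rfl fun i _ ↦ h2 i] at h1
  rw [← Finset.sum_smul, sum_choose_mul_pow_eq_factorial hm] at h1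
  exact (smul_eq_zero.1 h1).resolve_left (by exact_mod_cast m.factorial_ne_zero)

/-- A continuous multilinear form on the diagonal is a polynomial function. -/
theorem exists_polyFun_eq_multilinear {d k : ℕ}
    (A : ContinuousMultilinearMap ℝ (fun _ : Fin k ↦ Space d) ℂ) :
    ∃ P : MvPolynomial (Fin d) ℂ, P.totalDegree ≤ k ∧ ∀ x, polyFun P x = A fun _ ↦ x := by
  let e : Fin d → Space d := fun j ↦ EuclideanSpace.single j 1
  -- Expanding `x` in the basis `e` in all `k` slots gives one monomial for each choice `r` of basis
  -- vectors.
  refine ⟨∑ r : Fin k → Fin d, MvPolynomial.C (A fun i ↦ e (r i)) *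
    ∏ i, MvPolynomial.X (r i), ?_, fun x ↦ ?_⟩
  · refine MvPolynomial.totalDegree_finsetSum_le fun r _ ↦ ?_
    refine (MvPolynomial.totalDegree_mul _ _).trans ?_
    rw [MvPolynomial.totalDegree_C, zero_add]
    refine (MvPolynomial.totalDegree_finsetProd _ _).trans ?_
    simp
  · have hx : x = ∑ j, x j • e j := by
      ext l
      simp [e, Finset.sum_apply, Pi.single_apply]
    conv_rhs => rw [hx]
    rw [A.map_sum]
    simp only [polyFun, map_sum, map_mul, map_prod, MvPolynomial.eval_C, MvPolynomial.eval_X]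
    refine Finset.sum_congr rfl fun r _ ↦ ?_
    rw [A.map_smul_univ (fun i ↦ x (r i)) (fun i ↦ e (r i)), Complex.real_smul]
    push_cast
    ring

/-- The integral remainder in Taylor's formula at `0` involves the `m`-th derivative only on the
diagonal, so the hypothesis annihilates it without polarization. -/
theorem exists_polyFun_eq {d m : ℕ} (hm : 1 ≤ m) {g : Space d → ℂ} (hg : ContDiff ℝ ∞ g)
    (h : ∀ x y, iteratedFDeriv ℝ m g x (fun _ ↦ y) = 0) :
    ∃ P : MvPolynomial (Fin d) ℂ, P.totalDegree ≤ m - 1 ∧ polyFun P = g := by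
  choose P hP hPe using fun k ↦ exists_polyFun_eq_multilinear (iteratedFDeriv ℝ k g (0 : Space d))
  obtain ⟨n, rfl⟩ : ∃ n, m = n + 1 := ⟨m - 1, by omega⟩
  refine ⟨∑ k ∈ Finset.range (n + 1), MvPolynomial.C ((k.factorial : ℂ)⁻¹) * P k, ?_, ?_⟩
  · refine MvPolynomial.totalDegree_finsetSum_le fun k hk ↦ ?_
    refine (MvPolynomial.totalDegree_mul _ _).trans ?_
    rw [MvPolynomial.totalDegree_C, zero_add]
    have := hP k
    have := Finset.mem_range.1 hk
    omega
  · ext x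
    have ht := map_add_eq_sum_add_integral_iteratedFDeriv (f := g) (x := 0) (y := x) (n := n)
      fun t _ ↦ hg.contDiffAt.of_le (by exact_mod_cast le_top)
    simp only [h, smul_zero, intervalIntegral.integral_zero, add_zero, zero_add] at ht
    rw [ht]
    simp only [polyFun, map_sum, map_mul, MvPolynomial.eval_C]
    refine Finset.sum_congr rfl fun k _ ↦ ?_
    rw [← hPe k x, Complex.real_smul]
    simp [polyFun]

end Polynomial

noncomputable section

/-! ### Exchanging a distribution with a parameter integral. -/

section Fubini

/-- A linear functional bounded by the norm of a linear map into a normed space extends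
continuously along that map. -/
theorem exists_clm_comp_eq_of_norm_le {V X : Type*} [AddCommGroup V] [Module ℝ V]
    [NormedAddCommGroup X] [NormedSpace ℝ X] (J : V →ₗ[ℝ] X) (f : V →ₗ[ℝ] ℂ) (C : ℝ)
    (h : ∀ v, ‖f v‖ ≤ C * ‖J v‖) : ∃ F : X →L[ℝ] ℂ, ∀ v, F (J v) = f v := by
  -- The bound lets `f` descend to a bounded functional on the range of `J`; it then extends to `X`
  -- because its target `ℂ` is finite-dimensional.
  have hker : J.ker ≤ f.ker := fun v hv ↦ by
    have := h v
    rw [LinearMap.mem_ker.1 hv, norm_zero, mul_zero] at this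
    exact norm_le_zero_iff.1 this
  let f₀ : J.range →ₗ[ℝ] ℂ := (J.ker.liftQ f hker).comp J.quotKerEquivRange.symm.toLinearMap
  have hf₀ : ∀ v (hv : J v ∈ J.range), f₀ ⟨J v, hv⟩ = f v := fun v hv ↦ by
    simp [f₀, LinearMap.quotKerEquivRange_symm_apply_image]
  obtain ⟨F, hF⟩ := (f₀.mkContinuous C (by
    rintro ⟨_, v, rfl⟩
    exact (congrArg norm (hf₀ v ⟨v, rfl⟩)).le.trans (h v))).exist_extension_of_finiteDimensional_range
  refine ⟨F, fun v ↦ ?_⟩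
  have := congrArg (fun A ↦ A ⟨J v, v, rfl⟩) hF
  exact this.symm.trans (hf₀ v ⟨v, rfl⟩)

variable {E : Type} [NormedAddCommGroup E] [NormedSpace ℝ E]

theorem iteratedFDeriv_slice {G : Type*} [NormedAddCommGroup G] [NormedSpace ℝ G] {Ψ : E × E → G}
    (hΨ : ContDiff ℝ ∞ Ψ) (n : ℕ) (z y : E) :
    iteratedFDeriv ℝ n (fun x ↦ Ψ (x, y)) z =
      (iteratedFDeriv ℝ n Ψ (z, y)).compContinuousLinearMap
        fun _ ↦ ContinuousLinearMap.inl ℝ E E := by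
  -- The slice is a translate of `Ψ` composed with the linear map `inl`, so the chain rule for
  -- linear maps applies.
  have h := (ContinuousLinearMap.inl ℝ E E).iteratedFDeriv_comp_right (n := ∞) (i := n)
    (f := fun w ↦ Ψ (w + (0, y))) (hΨ.comp (by fun_prop)) z (by exact_mod_cast le_top)
  rw [iteratedFDeriv_comp_add_right] at h
  simpa [Function.comp_def] using h

theorem continuous_iteratedFDeriv_slice {G : Type*} [NormedAddCommGroup G] [NormedSpace ℝ G]
    {Ψ : E × E → G} (hΨ : ContDiff ℝ ∞ Ψ) (n : ℕ) :
    Continuous fun w : E × E ↦ iteratedFDeriv ℝ n (fun x ↦ Ψ (x, w.2)) w.1 := by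
  simp only [iteratedFDeriv_slice hΨ]
  exact (ContinuousMultilinearMap.compContinuousLinearMapL
    (F := G) fun _ : Fin n ↦ ContinuousLinearMap.inl ℝ E E).continuous.comp
    (hΨ.continuous_iteratedFDeriv (by exact_mod_cast le_top))

theorem hasCompactSupport_iteratedFDeriv_slice {G : Type*} [NormedAddCommGroup G]
    [NormedSpace ℝ G] {Ψ : E × E → G} (hΨ : ContDiff ℝ ∞ Ψ) (hs : HasCompactSupport Ψ) (n : ℕ) :
    HasCompactSupport fun w : E × E ↦ iteratedFDeriv ℝ n (fun x ↦ Ψ (x, w.2)) w.1 := by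
  simp only [iteratedFDeriv_slice hΨ]
  exact (hs.iteratedFDeriv (𝕜 := ℝ) n).comp_left
    (g := ContinuousMultilinearMap.compContinuousLinearMapL
      (F := G) fun _ : Fin n ↦ ContinuousLinearMap.inl ℝ E E) (map_zero _)

/-- Families of continuous functions on `K` with the values of derivatives of order `i ∈ s`. -/
def JetSpace (K : Compacts E) (s : Finset ℕ) : Type :=
  ∀ i : s, C(K, E [×i]→L[ℝ] ℝ)

instance (K : Compacts E) (s : Finset ℕ) : NormedAddCommGroup (JetSpace K s) :=
  inferInstanceAs (NormedAddCommGroup (∀ i : s, C(K, E [×i]→L[ℝ] ℝ)))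

instance (K : Compacts E) (s : Finset ℕ) : NormedSpace ℝ (JetSpace K s) :=
  inferInstanceAs (NormedSpace ℝ (∀ i : s, C(K, E [×i]→L[ℝ] ℝ)))

instance (K : Compacts E) (s : Finset ℕ) : CompleteSpace (JetSpace K s) :=
  inferInstanceAs (CompleteSpace (∀ i : s, C(K, E [×i]→L[ℝ] ℝ)))

/-- The value at `z` of the component of order `i`. -/
def jetEval (K : Compacts E) (s : Finset ℕ) (i : s) (z : K) :
    JetSpace K s →L[ℝ] E [×i]→L[ℝ] ℝ :=
  (ContinuousMap.evalCLM ℝ z).comp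
    (ContinuousLinearMap.proj (φ := fun i : s ↦ C(K, E [×i]→L[ℝ] ℝ)) i)

theorem jetSpace_ext {K : Compacts E} {s : Finset ℕ} {a b : JetSpace K s}
    (h : ∀ i z, jetEval K s i z a = jetEval K s i z b) : a = b :=
  funext fun i ↦ ContinuousMap.ext fun z ↦ h i z

theorem norm_jetEval_le {K : Compacts E} {s : Finset ℕ} (a : JetSpace K s) (i : s) (z : K) :
    ‖jetEval K s i z a‖ ≤ ‖a‖ :=
  (ContinuousMap.norm_coe_le_norm (a i) z).trans
    (norm_le_pi_norm (G := fun i : s ↦ C(K, E [×i]→L[ℝ] ℝ)) a i)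

theorem continuous_jetSpace {X : Type*} [TopologicalSpace X] {K : Compacts E} {s : Finset ℕ}
    {a : X → JetSpace K s} (h : ∀ i, Continuous fun w : X × K ↦ jetEval K s i w.2 (a w.1)) :
    Continuous a :=
  continuous_pi (A := fun i : s ↦ C(K, E [×i]→L[ℝ] ℝ)) fun i ↦
    ContinuousMap.continuous_of_continuous_uncurry _ (h i)

/-- The derivatives of order `i ∈ s` of a test function supported in `K`. -/
def jetLM (K : Compacts E) (s : Finset ℕ) : 𝓓_{K}(E, ℝ) →ₗ[ℝ] JetSpace K s where
  toFun φ i := ⟨fun z : K ↦ ContDiffMapSupportedIn.structureMapLM ℝ ⊤ i φ z, by fun_prop⟩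
  map_add' φ ψ := jetSpace_ext fun i z ↦ by
    change ContDiffMapSupportedIn.structureMapLM ℝ ⊤ i (φ + ψ) z =
      (ContDiffMapSupportedIn.structureMapLM ℝ ⊤ i φ +
        ContDiffMapSupportedIn.structureMapLM ℝ ⊤ i ψ) z
    rw [map_add]
  map_smul' r φ := jetSpace_ext fun i z ↦ by
    change ContDiffMapSupportedIn.structureMapLM ℝ ⊤ i (r • φ) z =
      (r • ContDiffMapSupportedIn.structureMapLM ℝ ⊤ i φ) z
    rw [map_smul]

theorem jetEval_jetLM (K : Compacts E) (s : Finset ℕ) (φ : 𝓓_{K}(E, ℝ)) (i : s) (z : K) :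
    jetEval K s i z (jetLM K s φ) = iteratedFDeriv ℝ i φ z :=
  congrFun (ContDiffMapSupportedIn.structureMapLM_top_apply (i := i) ℝ φ) z

/-- A distribution has finite order on each compact set. -/
theorem exists_clm_jetLM_eq (f : 𝓓'((⊤ : Opens E), ℂ)) (K : Compacts E) :
    ∃ (s : Finset ℕ) (F : JetSpace K s →L[ℝ] ℂ), ∀ φ : 𝓓_{K}(E, ℝ),
      F (jetLM K s φ) = f (TestFunction.ofSupportedIn (subset_univ _) φ) := by
  let T : 𝓓_{K}(E, ℝ) →L[ℝ] ℂ := f.comp (TestFunction.ofSupportedInCLM ℝ (subset_univ _))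
  -- `s` collects the orders of the finitely many seminorms that control `f` on `K`.
  obtain ⟨s, C, -, hC⟩ := Seminorm.bound_of_continuous
    (ContDiffMapSupportedIn.withSeminorms ℝ E ℝ ⊤ K) ((normSeminorm ℝ ℂ).comp T.toLinearMap)
    T.continuous.norm
  refine ⟨s, exists_clm_comp_eq_of_norm_le (jetLM K s) T.toLinearMap C fun φ ↦ ?_⟩
  refine (hC φ).trans ?_
  change (C : ℝ) * _ ≤ _
  gcongr
  refine Seminorm.finset_sup_apply_le (norm_nonneg _) fun i hi ↦ ?_
  refine (ContDiffMapSupportedIn.seminorm_top_le_iff ℝ (norm_nonneg _) i _).2 fun z hz ↦ ?_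
  rw [← jetEval_jetLM K s φ ⟨i, hi⟩ ⟨z, hz⟩]
  exact norm_jetEval_le _ _ _

/-- The test function `z ↦ Φ(z, x)`. -/
def slice (Φ : 𝓓((⊤ : Opens (E × E)), ℝ)) (x : E) : 𝓓((⊤ : Opens E), ℝ) where
  toFun z := Φ (z, x)
  contDiff' := Φ.contDiff.comp (by fun_prop)
  hasCompactSupport' := HasCompactSupport.intro
    (Φ.hasCompactSupport.isCompact.image continuous_fst) fun z hz ↦
      image_eq_zero_of_notMem_tsupport fun h ↦ hz ⟨_, h, rfl⟩
  tsupport_subset' := subset_univ _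

variable [MeasurableSpace E] [BorelSpace E] {μ : Measure E} [IsFiniteMeasureOnCompacts μ]

/-- Each differentiation under the integral replaces `Ψ` by its partial derivative, with values in
`E →L[ℝ] G`; hence the induction runs over all `G`. -/
theorem iteratedFDeriv_fiberIntegral (n : ℕ) :
    ∀ (G : Type) [NormedAddCommGroup G] [NormedSpace ℝ G] [CompleteSpace G] (Ψ : E × E → G),
      ContDiff ℝ ∞ Ψ → HasCompactSupport Ψ → ∀ z,
      iteratedFDeriv ℝ n (fun x ↦ ∫ y, Ψ (x, y) ∂μ) z =
        ∫ y, iteratedFDeriv ℝ n (fun x ↦ Ψ (x, y)) z ∂μ := by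
  induction n with
  | zero =>
    intro G _ _ _ Ψ hΨ hs z
    ext v
    rw [ContinuousMultilinearMap.integral_apply]
    · simp
    · exact integrable_slice (continuous_iteratedFDeriv_slice hΨ 0)
        (hasCompactSupport_iteratedFDeriv_slice hΨ hs 0) z
  | succ n ih =>
    intro G _ _ _ Ψ hΨ hs z
    let Ψ' : E × E → E →L[ℝ] G := fun w ↦ (fderiv ℝ Ψ w).comp (ContinuousLinearMap.inl ℝ E E)
    have hΨ' : ContDiff ℝ ∞ Ψ' := (hΨ.fderiv_right (m := ∞) (by simp)).clm_comp contDiff_const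
    have hs' : HasCompactSupport Ψ' := (hs.fderiv ℝ).comp_left (g := fun A : E × E →L[ℝ] G ↦
        A.comp (ContinuousLinearMap.inl ℝ E E)) (by simp)
    have h1 : fderiv ℝ (fun x ↦ ∫ y, Ψ (x, y) ∂μ) = fun x ↦ ∫ y, Ψ' (x, y) ∂μ :=
      funext fun z ↦ (hasFDerivAt_fiberIntegral hΨ hs z).fderiv
    have h2 : ∀ y, fderiv ℝ (fun x ↦ Ψ (x, y)) = fun x ↦ Ψ' (x, y) := fun y ↦ funext fun x ↦
      (((hΨ.differentiable (by simp)) (x, y)).hasFDerivAt.comp x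
        (hasFDerivAt_prodMk_left x y)).fderiv
    have hint := integrable_slice (μ := μ) (continuous_iteratedFDeriv_slice hΨ' n)
      (hasCompactSupport_iteratedFDeriv_slice hΨ' hs' n) z
    ext v
    rw [ContinuousMultilinearMap.integral_apply
      (integrable_slice (continuous_iteratedFDeriv_slice hΨ (n + 1))
        (hasCompactSupport_iteratedFDeriv_slice hΨ hs (n + 1)) z)]
    simp only [iteratedFDeriv_succ_apply_right, h1, h2]
    rw [ih _ Ψ' hΨ' hs', ContinuousMultilinearMap.integral_apply hint,
      ContinuousLinearMap.integral_apply]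
    exact ((ContinuousMultilinearMap.apply ℝ (fun _ : Fin n ↦ E) (E →L[ℝ] G)
      (Fin.init v)).integrable_comp hint)

/-- A distribution commutes with integration of test functions over a parameter. -/
theorem continuous_slice_and_fiberCLM_eq_integral (μ : Measure E) [IsFiniteMeasureOnCompacts μ]
    (f : 𝓓'((⊤ : Opens E), ℂ)) (Φ : 𝓓((⊤ : Opens (E × E)), ℝ)) :
    Continuous (fun x ↦ f (slice Φ x)) ∧ f (fiberCLM μ 0 Φ) = ∫ x, f (slice Φ x) ∂μ := by
  -- All slices of `Φ` and their integral are supported in this `K`, so one functional `F` on a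
  -- Banach space of jets represents `f` on all of them, and Bochner integration is available there.
  let K : Compacts E := ⟨_, Φ.hasCompactSupport.isCompact.image continuous_fst⟩
  have hK : ∀ z ∉ K, ∀ x, Φ (z, x) = 0 := fun z hz x ↦
    image_eq_zero_of_notMem_tsupport fun h ↦ hz ⟨_, h, rfl⟩
  obtain ⟨s, F, hF⟩ := exists_clm_jetLM_eq f K
  let γ : E → 𝓓_{K}(E, ℝ) := fun x ↦ ⟨slice Φ x, (slice Φ x).contDiff, fun z hz ↦ hK z hz x⟩
  let φ : 𝓓_{K}(E, ℝ) := ⟨fiberCLM μ 0 Φ, (fiberCLM μ 0 Φ).contDiff, fun z hz ↦ by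
    simp [fiberCLM_apply, hK z hz]⟩
  have hγ : ∀ x, F (jetLM K s (γ x)) = f (slice Φ x) := fun x ↦ hF (γ x)
  have hφ : F (jetLM K s φ) = f (fiberCLM μ 0 Φ) := hF φ
  have hcont : Continuous fun x ↦ jetLM K s (γ x) := by
    refine continuous_jetSpace fun i ↦ ?_
    have := (continuous_iteratedFDeriv_slice Φ.contDiff i).comp
      (show Continuous fun w : E × K ↦ ((w.2 : E), w.1) by fun_prop)
    refine this.congr fun w ↦ ?_
    exact (jetEval_jetLM K s (γ w.1) i w.2).symm
  have hsupp : HasCompactSupport fun x ↦ jetLM K s (γ x) := by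
    refine HasCompactSupport.intro (Φ.hasCompactSupport.isCompact.image continuous_snd)
      fun x hx ↦ ?_
    have : γ x = 0 := ContDiffMapSupportedIn.ext fun z ↦
      image_eq_zero_of_notMem_tsupport (f := Φ) (x := (z, x)) fun h ↦ hx ⟨_, h, rfl⟩
    rw [this, map_zero]
  have hint : Integrable (fun x ↦ jetLM K s (γ x)) μ :=
    hcont.integrable_of_hasCompactSupport hsupp
  -- Evaluations separate jets and commute with the Bochner integral, which reduces the claim to
  -- differentiation under the integral.
  have hjet : jetLM K s φ = ∫ x, jetLM K s (γ x) ∂μ := by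
    refine jetSpace_ext fun i z ↦ ?_
    rw [← (jetEval K s i z).integral_comp_comm hint]
    simp only [jetEval_jetLM]
    have := iteratedFDeriv_fiberIntegral (μ := μ) i ℝ Φ Φ.contDiff Φ.hasCompactSupport z
    refine Eq.trans ?_ this
    congr 1
    ext x
    exact (fiberCLM_apply μ 0 Φ x).trans (by simp)
  refine ⟨?_, ?_⟩
  · simp only [← hγ]
    exact F.continuous.comp hcont
  · rw [← hφ, hjet, ← F.integral_comp_comm hint]
    simp only [hγ]

end Fubini

/-! ### Test functions and convolution kernels. -/

section TestFunctions

variable {d : ℕ}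

/-- The test function `(x, y) ↦ φ(x) ψ(y)`. -/
def prodTestFunction (φ ψ : 𝓓((⊤ : Opens (Space d)), ℝ)) :
    𝓓((⊤ : Opens (Space d × Space d)), ℝ) where
  toFun w := φ w.1 * ψ w.2
  contDiff' := (φ.contDiff.comp contDiff_fst).mul (ψ.contDiff.comp contDiff_snd)
  hasCompactSupport' := HasCompactSupport.intro
    (φ.hasCompactSupport.isCompact.prod ψ.hasCompactSupport.isCompact) fun w hw ↦ by
      by_cases h : w.1 ∈ tsupport φ
      · simp [image_eq_zero_of_notMem_tsupport fun h' : w.2 ∈ tsupport ψ ↦ hw ⟨h, h'⟩]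
      · simp [image_eq_zero_of_notMem_tsupport h]
  tsupport_subset' := subset_univ _

/-- The test function `z ↦ φ(L z)`, for a homeomorphism `L` that is smooth. -/
def compTestFunction (φ : 𝓓((⊤ : Opens (Space d)), ℝ)) (L : Space d ≃ₜ Space d)
    (hL : ContDiff ℝ ∞ L) : 𝓓((⊤ : Opens (Space d)), ℝ) where
  toFun z := φ (L z)
  contDiff' := φ.contDiff.comp hL
  hasCompactSupport' := φ.hasCompactSupport.comp_homeomorph L
  tsupport_subset' := subset_univ _

/-- The translate `z ↦ θ(z - u)`. -/
def translate (θ : 𝓓((⊤ : Opens (Space d)), ℝ)) (u : Space d) : 𝓓((⊤ : Opens (Space d)), ℝ) :=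
  compTestFunction θ (Homeomorph.subRight u) (contDiff_id.sub contDiff_const)

theorem translate_apply (θ : 𝓓((⊤ : Opens (Space d)), ℝ)) (u z : Space d) :
    translate θ u z = θ (z - u) := rfl

/-- The dilate `v ↦ ψ(r⁻¹ v)`. -/
def dilate (ψ : 𝓓((⊤ : Opens (Space d)), ℝ)) {r : ℝ} (hr : r ≠ 0) :
    𝓓((⊤ : Opens (Space d)), ℝ) :=
  compTestFunction ψ (Homeomorph.smulOfNeZero r⁻¹ (inv_ne_zero hr))
    (contDiff_const_smul r⁻¹)

/-- The test function `(z, u) ↦ φ(u) θ(z - u)`, linear in `θ`. -/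
def convKernel (φ : 𝓓((⊤ : Opens (Space d)), ℝ)) :
    𝓓((⊤ : Opens (Space d)), ℝ) →ₗ[ℝ] 𝓓((⊤ : Opens (Space d × Space d)), ℝ) where
  toFun θ :=
    { toFun := fun w ↦ φ w.2 * θ (w.1 - w.2)
      contDiff' := (φ.contDiff.comp contDiff_snd).mul
        (θ.contDiff.comp (contDiff_fst.sub contDiff_snd))
      hasCompactSupport' := HasCompactSupport.intro
        ((φ.hasCompactSupport.isCompact.prod θ.hasCompactSupport.isCompact).image
          (show Continuous fun p : Space d × Space d ↦ (p.2 + p.1, p.1) by fun_prop))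
        fun w hw ↦ by
          by_cases h : w.2 ∈ tsupport φ
          · rw [image_eq_zero_of_notMem_tsupport fun h' : w.1 - w.2 ∈ tsupport θ ↦
              hw ⟨(w.2, w.1 - w.2), ⟨h, h'⟩, by simp⟩, mul_zero]
          · rw [image_eq_zero_of_notMem_tsupport h, zero_mul]
      tsupport_subset' := subset_univ _ }
  map_add' θ θ' := TestFunction.ext fun w ↦ mul_add _ _ _
  map_smul' r θ := TestFunction.ext fun w ↦ mul_left_comm _ _ _

theorem slice_convKernel (φ θ : 𝓓((⊤ : Opens (Space d)), ℝ)) (u : Space d) :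
    slice (convKernel φ θ) u = φ u • translate θ u := rfl

/-- The substitution `u = z - r y` turns the left integral into the convolution of `φ` with the
dilate of `ψ` normalized to keep its integral. It needs `r ≠ 0`. -/
theorem fiberCLM_smul_prodTestFunction (φ ψ : 𝓓((⊤ : Opens (Space d)), ℝ)) {r : ℝ} (hr : r ≠ 0) :
    fiberCLM volume (r • ContinuousLinearMap.id ℝ (Space d)) (prodTestFunction φ ψ) =
      fiberCLM volume 0 (convKernel φ (|r ^ d|⁻¹ • dilate ψ hr)) := by
  ext z
  rw [fiberCLM_apply, fiberCLM_apply]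
  change ∫ y, φ (z - r • y) * ψ y =
    ∫ y, φ y * (|r ^ d|⁻¹ * ψ (r⁻¹ • (z - 0 - y)))
  rw [← integral_sub_left_eq_self (fun y ↦ φ y * (|r ^ d|⁻¹ * ψ (r⁻¹ • (z - 0 - y)))) volume z]
  have h := Measure.integral_comp_smul (volume : Measure (Space d))
    (fun y ↦ φ (z - r • y) * (|r ^ d|⁻¹ * ψ y)) r⁻¹
  simp only [smul_smul, mul_inv_cancel₀ hr, one_smul] at h
  simp only [sub_zero, sub_sub_cancel]
  rw [h, ← integral_smul]
  congr 1
  ext y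
  have : |r ^ d| ≠ 0 := abs_ne_zero.2 (pow_ne_zero _ hr)
  simp only [finrank_euclideanSpace, Fintype.card_fin, inv_pow, inv_inv, smul_eq_mul]
  field_simp

theorem exists_testFunction_eventually_one (u : Space d) :
    ∃ φ : 𝓓((⊤ : Opens (Space d)), ℝ), ∀ᶠ x in nhds u, φ x = 1 := by
  let b : ContDiffBump u := ⟨1, 2, one_pos, one_lt_two⟩
  exact ⟨⟨b, b.contDiff, b.hasCompactSupport, subset_univ _⟩, b.eventuallyEq_one⟩

theorem exists_testFunction_integral_eq_one (d : ℕ) :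
    ∃ φ : 𝓓((⊤ : Opens (Space d)), ℝ), ∫ x, φ x = 1 := by
  let b : ContDiffBump (0 : Space d) := ⟨1, 2, one_pos, one_lt_two⟩
  exact ⟨⟨b.normed volume, b.contDiff_normed, b.hasCompactSupport_normed, subset_univ _⟩,
    b.integral_normed⟩

end TestFunctions

/-! ### Regularity of distributional solutions. -/

section Regularity

variable {d : ℕ} {f : Dist d}

/-- A solution of the Fréchet equation is invariant under a mollification. -/
theorem exists_eq_fiberCLM_convKernel {m : ℕ} {ε : ℝ} (hε : ε ≠ 0) {c : ℕ → ℝ}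
    (hf : ε • tensorOne f + ∑ i ∈ Finset.Icc 1 m, c i •
      compAdd f ((i : ℝ) • ContinuousLinearMap.id ℝ (Space d)) = 0) :
    ∃ θ, ∀ φ, f φ = f (fiberCLM volume 0 (convKernel φ θ)) := by
  obtain ⟨ψ, hψ⟩ := exists_testFunction_integral_eq_one d
  have hex : ∀ i ∈ Finset.Icc 1 m, ∃ η, ∀ φ,
      fiberCLM volume ((i : ℝ) • ContinuousLinearMap.id ℝ (Space d)) (prodTestFunction φ ψ) =
        fiberCLM volume 0 (convKernel φ η) := fun i hi ↦
    -- The witness is the normalized dilate of `ψ` by `i`; it is independent of `φ`.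
    ⟨_, fun φ ↦ fiberCLM_smul_prodTestFunction φ ψ
      (Nat.cast_ne_zero.2 (Nat.one_le_iff_ne_zero.1 (Finset.mem_Icc.1 hi).1))⟩
  choose! η hη using hex
  -- This is the tested equation solved for `f φ`.
  refine ⟨-ε⁻¹ • ∑ i ∈ Finset.Icc 1 m, c i • η i, fun φ ↦ ?_⟩
  have h : ε • tensorOne f (prodTestFunction φ ψ) + ∑ i ∈ Finset.Icc 1 m, c i •
      compAdd f ((i : ℝ) • ContinuousLinearMap.id ℝ (Space d)) (prodTestFunction φ ψ) = 0 := by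
    have h0 := congrArg (fun T : DistProd d ↦ T (prodTestFunction φ ψ)) hf
    simpa using h0
  have hcomp : ∀ i ∈ Finset.Icc 1 m,
      compAdd f ((i : ℝ) • ContinuousLinearMap.id ℝ (Space d)) (prodTestFunction φ ψ) =
        f (fiberCLM volume 0 (convKernel φ (η i))) := fun i hi ↦ congrArg f (hη i hi φ)
  rw [tensorOne_apply_prod f _ φ ψ fun _ _ ↦ rfl, hψ, Complex.ofReal_one, mul_one,
    Finset.sum_congr rfl fun i hi ↦ by rw [hcomp i hi]] at h
  simp only [map_smul, map_sum]
  rw [eq_neg_of_add_eq_zero_right h, smul_neg, neg_smul, neg_neg, smul_smul, inv_mul_cancel₀ hε,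
    one_smul]

theorem exists_contDiff_eq_integral {θ : 𝓓((⊤ : Opens (Space d)), ℝ)}
    (hθ : ∀ φ, f φ = f (fiberCLM volume 0 (convKernel φ θ))) :
    ∃ g : Space d → ℂ, ContDiff ℝ ∞ g ∧ ∀ φ, f φ = ∫ x, φ x • g x := by
  let g : Space d → ℂ := fun u ↦ f (translate θ u)
  have hslice : ∀ φ u, f (slice (convKernel φ θ) u) = φ u • g u := fun φ u ↦ by
    rw [slice_convKernel, map_smul]
  have hg : ∀ φ, f φ = ∫ x, φ x • g x := fun φ ↦ by
    rw [hθ, (continuous_slice_and_fiberCLM_eq_integral volume f _).2]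
    simp only [hslice]
  -- Only `φ • g` is known to be continuous; choosing `φ = 1` near `u` transfers this to `g`.
  have hc : Continuous g := continuous_iff_continuousAt.2 fun u ↦ by
    obtain ⟨φ, hφ⟩ := exists_testFunction_eventually_one u
    have h := (continuous_slice_and_fiberCLM_eq_integral volume f (convKernel φ θ)).1.continuousAt
      (x := u)
    simp only [hslice] at h
    exact h.congr (hφ.mono fun x hx ↦ by simp only [hx, one_smul])
  refine ⟨g, ?_, hg⟩
  -- Representing `f` by `g` at the test function `translate θ u` gives `g(u) = ∫ θ(x - u) g(x) dx`,
  -- so `g` inherits the smoothness of `θ`.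
  have hconv : g = MeasureTheory.convolution (fun v ↦ θ (-v)) g
      (ContinuousLinearMap.lsmul ℝ ℝ) volume := by
    ext u
    rw [MeasureTheory.convolution_eq_swap]
    refine (hg (translate θ u)).trans ?_
    simp [translate_apply]
  rw [hconv]
  exact (θ.hasCompactSupport.comp_homeomorph (Homeomorph.neg _)).contDiff_convolution_left _
    (θ.contDiff.comp contDiff_neg) hc.locallyIntegrable

/-- Fubini and the translation `x = z - c y` identify the transposed definition with substitution
into the function `g`. -/
theorem compAdd_apply_eq_integral {g : Space d → ℂ} (hc : Continuous g)
    (hg : ∀ φ, f φ = ∫ x, φ x • g x) (c : Space d →L[ℝ] Space d)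
    (Φ : 𝓓((⊤ : Opens (Space d × Space d)), ℝ)) :
    compAdd f c Φ = ∫ w, Φ w • g (w.1 + c w.2) := by
  have hint : Integrable (fun w : Space d × Space d ↦ Φ (shear c w) • g w.1)
      (volume.prod volume) :=
    (Continuous.integrable_of_hasCompactSupport
      ((Φ.continuous.comp (shear c).continuous).smul (hc.comp continuous_fst))
      (hasCompactSupport_comp_shear c Φ.hasCompactSupport).smul_right)
  have hint' : Integrable (fun w : Space d × Space d ↦ Φ w • g (w.1 + c w.2))
      (volume.prod volume) :=
    (Continuous.integrable_of_hasCompactSupport (by fun_prop) Φ.hasCompactSupport.smul_right)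
  calc compAdd f c Φ = ∫ z, fiberCLM volume c Φ z • g z := hg _
    _ = ∫ z, ∫ y, Φ (z - c y, y) • g z := by
      simp only [fiberCLM_apply, integral_smul_const]
    _ = ∫ y, ∫ z, Φ (z - c y, y) • g z := integral_integral_swap hint
    _ = ∫ y, ∫ x, Φ (x, y) • g (x + c y) := by
      congr 1
      ext y
      rw [← integral_add_right_eq_self _ (c y)]
      simp
    _ = ∫ w, Φ w • g (w.1 + c w.2) := (integral_prod_symm _ hint').symm

/-- A continuous representative satisfies the Fréchet equation pointwise. -/
theorem pointwise_eq_zero {m : ℕ} {ε : ℝ} {c : ℕ → ℝ}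
    (hf : ε • tensorOne f + ∑ i ∈ Finset.Icc 1 m, c i •
      compAdd f ((i : ℝ) • ContinuousLinearMap.id ℝ (Space d)) = 0)
    {g : Space d → ℂ} (hc : Continuous g) (hg : ∀ φ, f φ = ∫ x, φ x • g x) (x y : Space d) :
    ε • g x + ∑ i ∈ Finset.Icc 1 m, c i • g (x + (i : ℝ) • y) = 0 := by
  let H : Space d × Space d → ℂ := fun w ↦
    ε • g w.1 + ∑ i ∈ Finset.Icc 1 m, c i • g (w.1 + (i : ℝ) • w.2)
  have hH : Continuous H := by fun_prop
  -- `H` integrates to zero against every test function on the product, so it vanishes almost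
  -- everywhere.
  have hae : ∀ᵐ w, H w = 0 := by
    refine ae_eq_zero_of_integral_contDiff_smul_eq_zero hH.locallyIntegrable fun φ hφ hs ↦ ?_
    let Φ : 𝓓((⊤ : Opens (Space d × Space d)), ℝ) := ⟨φ, hφ, hs, subset_univ _⟩
    have hi : ∀ L : Space d →L[ℝ] Space d, Integrable fun w ↦ Φ w • g (w.1 + L w.2) := fun L ↦
      Continuous.integrable_of_hasCompactSupport (by fun_prop) Φ.hasCompactSupport.smul_right
    -- `tensorOne f` is by definition `compAdd f 0`, so all terms have the same form.
    have h0 : ε • compAdd f 0 Φ + ∑ i ∈ Finset.Icc 1 m, c i •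
        compAdd f ((i : ℝ) • ContinuousLinearMap.id ℝ (Space d)) Φ = 0 := by
      have h0 := congrArg (fun T : DistProd d ↦ T Φ) hf
      simp only [add_apply, smul_apply, sum_apply, zero_apply] at h0
      exact h0
    simp only [compAdd_apply_eq_integral hc hg, ← integral_smul] at h0
    have hi' := fun i : ℕ ↦
      (hi ((i : ℝ) • ContinuousLinearMap.id ℝ (Space d))).fun_smul (c i)
    rw [← integral_finsetSum _ fun i _ ↦ hi' i, ← integral_add ((hi 0).fun_smul ε)
      (integrable_finsetSum _ fun i _ ↦ hi' i)] at h0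
    rw [← h0]
    congr 1
    ext1 w
    simp only [H, smul_add, Finset.smul_sum, zero_apply, add_zero, smul_apply,
      ContinuousLinearMap.id_apply]
    congr 1
    · exact smul_comm _ _ _
    · exact Finset.sum_congr rfl fun i _ ↦ smul_comm _ _ _
  -- Lebesgue measure charges nonempty open sets, so continuous functions that agree almost
  -- everywhere agree everywhere.
  have := (hH.ae_eq_iff_eq volume continuous_const).1 hae
  exact congrFun this (x, y)

end Regularity

end

end FrechetDistribution

theorem theorem7 (d m : ℕ) (hm : 1 ≤ m) (f : FrechetDistribution.Dist d) (ε : ℝ)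
    (hε : ε = 1 ∨ ε = (-1) ^ m)
    (hf : ε • FrechetDistribution.tensorOne f +
      ∑ i ∈ Finset.Icc 1 m, ((m.choose i : ℝ) * (-1) ^ (m - i)) •
        FrechetDistribution.compAdd f
          ((i : ℝ) • ContinuousLinearMap.id ℝ (FrechetDistribution.Space d)) = 0) :
    ∃ P : MvPolynomial (Fin d) ℂ, P.totalDegree ≤ m - 1 ∧
      FrechetDistribution.EqFunction f (FrechetDistribution.polyFun P) := by
  have hε0 : ε ≠ 0 := by
    rcases hε with rfl | rfl
    · exact one_ne_zero
    · exact pow_ne_zero _ (by norm_num)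
  obtain ⟨θ, hθ⟩ := FrechetDistribution.exists_eq_fiberCLM_convKernel hε0
    (c := fun i ↦ (m.choose i : ℝ) * (-1) ^ (m - i)) hf
  obtain ⟨g, hgs, hg⟩ := FrechetDistribution.exists_contDiff_eq_integral hθ
  obtain ⟨P, hP, hPg⟩ := FrechetDistribution.exists_polyFun_eq hm hgs
    (FrechetDistribution.iteratedFDeriv_apply_const_eq_zero hm hgs
      (FrechetDistribution.pointwise_eq_zero
        (c := fun i ↦ (m.choose i : ℝ) * (-1) ^ (m - i)) hf hgs.continuous hg))
  refine ⟨P, hP, ?_, fun φ ↦ ?_⟩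
  · rw [hPg]
    exact hgs.continuous.locallyIntegrable
  · rw [hPg, hg φ]
    simp only [Complex.real_smul]
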